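/- **Theorem (Diamond DAG Lower Bound).** *Model.* The asymmetric RAM has a symmetric memory of $M\ge 1$ words, an asymmetric memory of unboundedly many words, and an integer write cost $\omega\ge 1$. Each word holds at most one (atomic) vertex value. An instruction reads some words, from either memory, and writes at most one word, in either memory. For a sequence of executed instructions, the cost $Q$ is the number of reads from the asymmetric memory plus $\omega$ times the number of writes to it, and the work $W$ is $Q$ plus the number of reads from and writes to the symmetric memory. *Problem.* In the DAG computation problem, initially the values of the input vertices (in-degree $0$) are in the asymmetric memory and no other vertex value is in memory. An instruction may copy a word, or write the value of a non-input vertex provided that it reads the values of all immediate predecessors of that vertex, or do anything else that produces no vertex value. Vertices may be recomputed arbitrarily often. At the end the value of every output vertex (out-degree $0$) must be in memory. *Diamond DAG.* The $n\times n$ diamond DAG has the vertices $(i,j)$, $0\le i,j\le n-1$, and the edges $(i,j)\to(i+1,j)$ for $i<n-1$ and $(i,j)\to(i,j+1)$ for $j<n-1$. *Claim.* There is an absolute constant $c>0$ such that for all integers $M\ge 1$, $\omega\ge1$ and $n$, every computation that solves the DAG computation problem on the $n\times n$ diamond DAG satisfies $$Q\ \ge\ c\,\frac{\omega n^2}{M}\quad\text{if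 } n\ge 2M,\qquad\text{and}\qquad W\ \ge\ c\,(Q+n^2)\quad\text{if } n\ge 2 .$$ In particular, for the minimal costs, $Q(n)=\Omega(\omega n^2/M)$ and $W(n)=\Omega(Q(n)+n^2)$. -/

import Mathlib

namespace AsymRAM

/-- A vertex is an input of the DAG if its in-degree is zero. -/
def IsInput {V : Type*} (G : Digraph V) (v : V) : Prop := ∀ u, ¬ G.Adj u v

/-- A vertex is an output of the DAG if its out-degree is zero. -/
def IsOutput {V : Type*} (G : Digraph V) (v : V) : Prop := ∀ w, ¬ G.Adj v w

/-- The `n × n` diamond DAG: vertex `(i, j)` has an edge to `(i + 1, j)` and one to `(i, j + 1)`,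
whenever these lie in the grid. -/
def diamond (n : ℕ) : Digraph (Fin n × Fin n) where
  Adj p q := (p.1.val + 1 = q.1.val ∧ p.2.val = q.2.val) ∨
    (p.1.val = q.1.val ∧ p.2.val + 1 = q.2.val)

/-- Memory locations: `Sum.inl` is one of the `M` words of the symmetric memory, `Sum.inr` a word
of the unbounded asymmetric memory. -/
abbrev Loc (M : ℕ) : Type := Fin M ⊕ ℕ

/-- Contents of the memory. A word holds the (atomic) value of one vertex, `some v`, or a word that
is not the value of a vertex, `none`. -/
abbrev Memory (M : ℕ) (V : Type*) : Type _ := Loc M → Option V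

/-- The value of vertex `v` is present somewhere in memory. -/
def Holds {M : ℕ} {V : Type*} (μ : Memory M V) (v : V) : Prop := ∃ l, μ l = some v

/-- Executed instructions. Operands and results may be in either memory. -/
inductive Instr (M : ℕ) (V : Type*) : Type _
  /-- Compute the value of vertex `v` from the words at `args` and store it at `dst`. -/
  | compute (v : V) (args : List (Loc M)) (dst : Loc M)
  /-- Copy the word at `src` to `dst`. -/
  | move (src dst : Loc M)
  /-- Any other instruction (index arithmetic, comparison, branch, and so on): it reads the words
  at `args` and may overwrite a location by a word that is not the value of a vertex. -/
  | other (args : List (Loc M)) (dst : Option (Loc M))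

namespace Instr

variable {M : ℕ} {V : Type*}

/-- The locations read by an instruction. -/
def reads : Instr M V → List (Loc M)
  | compute _ args _ => args
  | move src _ => [src]
  | other args _ => args

/-- The locations written by an instruction (at most one). -/
def writes : Instr M V → List (Loc M)
  | compute _ _ dst => [dst]
  | move _ dst => [dst]
  | other _ dst => dst.toList

/-- The DAG computation rule: the value of a non-input vertex can be computed from the values of
all its immediate predecessors, which the instruction has to read. -/
def Allowed (G : Digraph V) (μ : Memory M V) : Instr M V → Prop
  | compute v args _ => ¬ IsInput G v ∧ ∀ u, G.Adj u v → ∃ l ∈ args, μ l = some u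
  | move _ _ => True
  | other _ _ => True

/-- The memory after the instruction. -/
def exec (μ : Memory M V) : Instr M V → Memory M V
  | compute v _ dst => Function.update μ dst (some v)
  | move src dst => Function.update μ dst (μ src)
  | other _ none => μ
  | other _ (some dst) => Function.update μ dst none

/-- Reads of the asymmetric memory plus `ω` times the writes to it. -/
def ioCost (ω : ℕ) (I : Instr M V) : ℕ :=
  I.reads.countP Sum.isRight + ω * I.writes.countP Sum.isRight

/-- Reads of and writes to the symmetric memory. -/
def fastCost (I : Instr M V) : ℕ :=
  I.reads.countP Sum.isLeft + I.writes.countP Sum.isLeft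

end Instr

/-- `Run G μ P ν`: executing the instructions `P` one after the other from memory `μ` obeys the
DAG computation rule throughout and ends in memory `ν`. -/
inductive Run {M : ℕ} {V : Type*} (G : Digraph V) :
    Memory M V → List (Instr M V) → Memory M V → Prop
  | nil (μ : Memory M V) : Run G μ [] μ
  | cons {μ ν : Memory M V} {I : Instr M V} {P : List (Instr M V)} :
      I.Allowed G μ → Run G (I.exec μ) P ν → Run G μ (I :: P) ν

/-- At the start the values of the inputs are in the asymmetric memory, and no other value of a
vertex is present anywhere. -/
def IsInitial {M : ℕ} {V : Type*} (G : Digraph V) (μ : Memory M V) : Prop :=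
  (∀ v, IsInput G v → ∃ a : ℕ, μ (Sum.inr a) = some v) ∧
  (∀ i : Fin M, μ (Sum.inl i) = none) ∧
  (∀ (a : ℕ) (v : V), μ (Sum.inr a) = some v → IsInput G v)

/-- The instruction sequence `P` solves the DAG computation problem for `G`: started from some
layout of the inputs, it ends with the value of every output in memory. Recomputation of vertices
is unrestricted. -/
def Solves {M : ℕ} {V : Type*} (G : Digraph V) (P : List (Instr M V)) : Prop :=
  ∃ μ ν : Memory M V, IsInitial G μ ∧ Run G μ P ν ∧ ∀ v, IsOutput G v → Holds ν v

/-- The asymmetric I/O cost `Q` of a computation. -/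
def ioCost {M : ℕ} {V : Type*} (ω : ℕ) (P : List (Instr M V)) : ℕ :=
  (P.map (Instr.ioCost ω)).sum

/-- The asymmetric work `W` of a computation. -/
def work {M : ℕ} {V : Type*} (ω : ℕ) (P : List (Instr M V)) : ℕ :=
  ioCost ω P + (P.map Instr.fastCost).sum

end AsymRAM

/-! In a `k × k` block, consider the monotone lattice paths from the antidiagonal to the last
corner. Initially none of them meets a held vertex; once the corner is held, all do. At an
instruction that blocks the last free paths, let `f` be a path free just before. A value that newly
appears has all its predecessors in memory, so a new vertex of `f` beyond its start would have a
held predecessor on `f`. Hence `f` is now blocked only at its start. From each other start, run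
straight to `f` and then along `f`: the block must occur before the merge, and these `k` initial
pieces are disjoint, so `k` vertices of the block are held at once (`exists_card_of_blocked`,
`exists_visits_block`). This counts memory states, so recomputation does not matter.

With `k = 2 * M`, at least `M` of these values lie in asymmetric memory and, not being inputs, were
written there. Summing over disjoint blocks bounds `Q`. For `W`, every non-input vertex is written
somewhere. -/

namespace AsymRAM

/-! ### Runs, newly appearing values and counting writes -/

section Runs

variable {M : ℕ} {V : Type*} {G : Digraph V}

/-- The memory `ν` occurs during the execution of `P` from `μ`. -/
def Visits (G : Digraph V) (μ : Memory M V) (P : List (Instr M V)) (ν : Memory M V) : Prop :=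
  ∃ P₁, P₁ <+: P ∧ Run G μ P₁ ν

theorem Run.append {μ ν ξ : Memory M V} {P P' : List (Instr M V)} (h : Run G μ P ν)
    (h' : Run G ν P' ξ) : Run G μ (P ++ P') ξ := by
  induction h with
  | nil μ => exact h'
  | cons ha _ ih => exact Run.cons ha (ih h')

/-- A property that fails at the start of a run and holds at its end becomes true at some
instruction. -/
theorem Run.exists_first {μ ν : Memory M V} {P : List (Instr M V)} (h : Run G μ P ν)
    (p : Memory M V → Prop) (h0 : ¬ p μ) (h1 : p ν) :
    ∃ (P₁ : List (Instr M V)) (I : Instr M V) (ξ : Memory M V), P₁ ++ [I] <+: P ∧ Run G μ P₁ ξ ∧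
      I.Allowed G ξ ∧ ¬ p ξ ∧ p (I.exec ξ) := by
  induction h with
  | nil μ => exact absurd h1 h0
  | @cons μ ν I P ha hr ih =>
    by_cases hp : p (I.exec μ)
    · exact ⟨[], I, μ, by simp, Run.nil μ, ha, h0, hp⟩
    · obtain ⟨P₁, J, ξ, hpre, hrun, hJ, hn, hy⟩ := ih hp h1
      exact ⟨I :: P₁, J, ξ, by simpa using hpre, Run.cons ha hrun, hJ, hn, hy⟩

/-- A property that fails at the start and holds at a visited memory becomes true between two
consecutive visited memories. -/
theorem Visits.exists_first {μ ν : Memory M V} {P : List (Instr M V)} (h : Visits G μ P ν)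
    (p : Memory M V → Prop) (h0 : ¬ p μ) (h1 : p ν) :
    ∃ (I : Instr M V) (ξ : Memory M V), Visits G μ P ξ ∧ Visits G μ P (I.exec ξ) ∧
      I.Allowed G ξ ∧ ¬ p ξ ∧ p (I.exec ξ) := by
  obtain ⟨P', hP', hr⟩ := h
  obtain ⟨P₁, I, ξ, hpre, hrun, hI, hn, hy⟩ := hr.exists_first p h0 h1
  have hpre' := hpre.trans hP'
  exact ⟨I, ξ, ⟨P₁, (List.prefix_append _ _).trans hpre', hrun⟩,
    ⟨_, hpre', hrun.append (Run.cons hI (Run.nil _))⟩, hI, hn, hy⟩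

theorem Instr.exec_apply_of_notMem_writes {I : Instr M V} {μ : Memory M V} {l : Loc M}
    (hl : l ∉ I.writes) : I.exec μ l = μ l := by
  cases I with
  | compute v args dst =>
    exact Function.update_of_ne (by simpa [Instr.writes] using hl) _ _
  | move src dst =>
    exact Function.update_of_ne (by simpa [Instr.writes] using hl) _ _
  | other args dst =>
    cases dst with
    | none => rfl
    | some dst => exact Function.update_of_ne (by simpa [Instr.writes, eq_comm] using hl) _ _

/-- A value that appears in memory has just been computed from its predecessors. -/
theorem Instr.preds_of_new {I : Instr M V} {μ : Memory M V} {v : V} (ha : I.Allowed G μ)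
    (h0 : ¬ Holds μ v) (h1 : Holds (I.exec μ) v) : ∀ u, G.Adj u v → Holds μ u := by
  obtain ⟨l, hl⟩ := h1
  have hne : μ l ≠ some v := fun h => h0 ⟨l, h⟩
  cases I with
  | compute w args dst =>
    by_cases hd : l = dst
    · subst hd
      simp only [Instr.exec, Function.update_self, Option.some.injEq] at hl
      subst hl
      intro u hu
      obtain ⟨l', -, hl'⟩ := ha.2 u hu
      exact ⟨l', hl'⟩
    · simp [Instr.exec, Function.update_of_ne hd, hne] at hl
  | move src dst =>
    by_cases hd : l = dst
    · subst hd
      simp only [Instr.exec, Function.update_self] at hl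
      exact absurd ⟨src, hl⟩ h0
    · simp [Instr.exec, Function.update_of_ne hd, hne] at hl
  | other args dst =>
    cases dst with
    | none => exact absurd hl hne
    | some dst =>
      by_cases hd : l = dst
      · subst hd
        simp [Instr.exec] at hl
      · simp [Instr.exec, Function.update_of_ne hd, hne] at hl

/-- The number of distinct new values that ever appear in a part `p` of the memory is at most the
number of writes to that part. -/
theorem exists_finset_written (p : Loc M → Bool) (P : List (Instr M V)) (μ : Memory M V) :
    ∃ S : Finset V, S.card ≤ (P.map fun I => I.writes.countP p).sum ∧
      ∀ ν, Visits G μ P ν → ∀ l v, p l = true → ν l = some v →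
        (∃ l', p l' = true ∧ μ l' = some v) ∨ v ∈ S := by
  classical
  induction P generalizing μ with
  | nil =>
    refine ⟨∅, by simp, ?_⟩
    rintro ν ⟨P₁, hP₁, hr⟩ l v hl hv
    obtain rfl := List.prefix_nil.1 hP₁
    cases hr
    exact Or.inl ⟨l, hl, hv⟩
  | cons I P ih =>
    obtain ⟨S, hS, hval⟩ := ih (I.exec μ)
    refine ⟨((I.writes.filter p).filterMap (I.exec μ)).toFinset ∪ S, ?_, ?_⟩
    · refine (Finset.card_union_le _ _).trans ?_
      rw [List.map_cons, List.sum_cons, List.countP_eq_length_filter]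
      exact Nat.add_le_add ((List.toFinset_card_le _).trans (List.length_filterMap_le _ _)) hS
    · rintro ν ⟨P₁, hP₁, hr⟩ l v hl hv
      cases hr with
      | nil => exact Or.inl ⟨l, hl, hv⟩
      | @cons _ _ J P₂ ha hr =>
        obtain ⟨rfl, hP₂⟩ := List.cons_prefix_cons.1 hP₁
        rcases hval ν ⟨P₂, hP₂, hr⟩ l v hl hv with ⟨l', hl', hv'⟩ | h
        · by_cases hw : l' ∈ J.writes
          · right
            simp only [Finset.mem_union, List.mem_toFinset, List.mem_filterMap, List.mem_filter]
            exact Or.inl ⟨l', ⟨hw, hl'⟩, hv'⟩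
          · exact Or.inl ⟨l', hl', by rw [← hv', Instr.exec_apply_of_notMem_writes hw]⟩
        · exact Or.inr (Finset.mem_union_right _ h)

theorem mul_asym_writes_le_ioCost (ω : ℕ) (P : List (Instr M V)) :
    ω * (P.map fun I => I.writes.countP Sum.isRight).sum ≤ ioCost ω P := by
  induction P with
  | nil => simp
  | cons I P ih =>
    simp only [ioCost, List.map_cons, List.sum_cons, Instr.ioCost, Nat.mul_add] at ih ⊢
    omega

theorem writes_le_work {ω : ℕ} (hω : 1 ≤ ω) (P : List (Instr M V)) :
    (P.map fun I => I.writes.countP fun _ => true).sum ≤ work ω P := by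
  induction P with
  | nil => simp
  | cons I P ih =>
    have h1 : I.writes.countP (fun _ => true) =
        I.writes.countP Sum.isRight + I.writes.countP Sum.isLeft := by
      rw [List.countP_true]
      have h := List.length_eq_countP_add_countP (Sum.isRight (α := Fin M) (β := ℕ)) (l := I.writes)
      simpa using h
    have h2 : I.writes.countP Sum.isRight ≤ ω * I.writes.countP Sum.isRight :=
      Nat.le_mul_of_pos_left _ hω
    simp only [work, ioCost, List.map_cons, List.sum_cons, Instr.ioCost, Instr.fastCost] at ih ⊢
    omega

end Runs

/-! ### Blocking sets of monotone lattice paths -/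

section LatticePaths

/-- `f t` is the first coordinate after `t` steps of a monotone lattice path that starts on the
antidiagonal of a `k × k` grid and ends in its last corner; after `t` steps the sum of the
coordinates is `k - 1 + t`. -/
def IsGridPath (k : ℕ) (f : ℕ → ℕ) : Prop :=
  (∀ t < k, t ≤ f t ∧ f t < k) ∧ ∀ t, t + 1 < k → f (t + 1) = f t ∨ f (t + 1) = f t + 1

/-- If the set `R` meets every path, but some path at most at its start, then it contains at least
`k` points. -/
theorem exists_card_of_blocked {k : ℕ} {R : ℕ → ℕ → Prop} {f : ℕ → ℕ} (hf : IsGridPath k f)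
    (hR : ∀ g, IsGridPath k g → ∃ t < k, R t (g t)) (hfR : ∀ t, 0 < t → t < k → ¬ R t (f t)) :
    ∃ S : Finset (ℕ × ℕ), S.card = k ∧ ∀ p ∈ S, p.1 ≤ p.2 ∧ p.2 < k ∧ R p.1 p.2 := by
  classical
  have key : ∀ m : ℕ, ∃ p : ℕ × ℕ, m < k → (p.1 < k ∧ p.1 ≤ p.2 ∧ p.2 < k ∧ R p.1 p.2) ∧
      ((m < f 0 ∧ p.2 = m + p.1 ∧ p.2 < f p.1) ∨
        (f 0 < m ∧ p.2 = m ∧ f p.1 < p.2) ∨ (m = f 0 ∧ p.1 = 0 ∧ p.2 = m)) := by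
    intro m
    by_cases hm : m < k
    swap
    · exact ⟨0, fun h => absurd h hm⟩
    have hk : 0 < k := by omega
    rcases lt_or_ge m (f 0) with hlt | hge
    -- Increase the first coordinate until `f` is reached, then follow `f`.
    · have hg : IsGridPath k fun t => min (m + t) (f t) := by
        refine ⟨fun t ht => ?_, fun t ht => ?_⟩
        · have := hf.1 t ht
          simp only
          omega
        · have := hf.2 t ht
          simp only
          omega
      obtain ⟨t, ht, hRt⟩ := hR _ hg
      have hlt' : m + t < f t := by
        by_contra hcon
        rw [min_eq_right (by omega)] at hRt
        rcases Nat.eq_zero_or_pos t with rfl | hpos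
        · omega
        · exact hfR t hpos ht hRt
      rw [min_eq_left (by omega)] at hRt
      have := hf.1 t ht
      exact ⟨(t, m + t), fun _ => ⟨⟨ht, by simp, by simp only; omega, hRt⟩,
        Or.inl ⟨hlt, rfl, hlt'⟩⟩⟩
    -- Keep the first coordinate equal to `m` until `f` reaches it, then follow `f`.
    · have hg : IsGridPath k fun t => max m (f t) := by
        refine ⟨fun t ht => ?_, fun t ht => ?_⟩
        · have := hf.1 t ht
          simp only
          omega
        · have := hf.2 t ht
          simp only
          omega
      obtain ⟨t, ht, hRt⟩ := hR _ hg
      have hb := hg.1 t ht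
      rcases lt_or_ge (f t) m with hlt' | hge'
      · simp only [max_eq_left hlt'.le] at hb hRt
        refine ⟨(t, m), fun _ => ⟨⟨ht, hb.1, hb.2, hRt⟩, ?_⟩⟩
        rcases hge.eq_or_lt with h | h
        -- This case is vacuous, because `f` is nondecreasing.
        · obtain rfl : t = 0 := by
            by_contra h0
            have mono : ∀ s, s < k → f 0 ≤ f s := by
              intro s
              induction s with
              | zero => intro _; exact le_rfl
              | succ s ih =>
                intro hs
                have := ih (by omega)
                have := hf.2 s hs
                omega
            have := mono t ht
            omega
          exact Or.inr (Or.inr ⟨h.symm, rfl, rfl⟩)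
        · exact Or.inr (Or.inl ⟨h, rfl, hlt'⟩)
      · rw [max_eq_right hge'] at hRt
        obtain rfl : t = 0 := by
          by_contra h0
          exact hfR t (Nat.pos_of_ne_zero h0) ht hRt
        obtain rfl : m = f 0 := by omega
        exact ⟨(0, f 0), fun _ => ⟨⟨ht, Nat.zero_le _, hm, hRt⟩, Or.inr (Or.inr ⟨rfl, rfl, rfl⟩)⟩⟩
  choose w hw using key
  refine ⟨(Finset.range k).image w, ?_, ?_⟩
  · rw [Finset.card_image_of_injOn, Finset.card_range]
    -- The side of `f` on which the point lies determines the case, and `m` is then `p.2 - p.1` or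
    -- `p.2`.
    intro m hm m' hm' heq
    have h1 := (hw m (by simpa using hm)).2
    have h2 := (hw m' (by simpa using hm')).2
    rw [← heq] at h2
    rcases h1 with h1 | h1 | h1 <;> rcases h2 with h2 | h2 | h2 <;> omega
  · intro p hp
    obtain ⟨m, hm, rfl⟩ := Finset.mem_image.1 hp
    exact (hw m (by simpa using hm)).1.2

end LatticePaths

/-! ### Blocks of the diamond and the two write bounds -/

section Diamond

variable {M n : ℕ}

theorem not_isInput_diamond {v : Fin n × Fin n} (h : 0 < v.1.val + v.2.val) :
    ¬ IsInput (diamond n) v := by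
  obtain ⟨⟨i, hi⟩, ⟨j, hj⟩⟩ := v
  intro hin
  rcases Nat.eq_zero_or_pos i with rfl | hi0
  · simp only [Nat.zero_add] at h
    exact hin (⟨0, hi⟩, ⟨j - 1, by omega⟩) (Or.inr ⟨rfl, Nat.sub_add_cancel h⟩)
  · exact hin (⟨i - 1, by omega⟩, ⟨j, hj⟩) (Or.inl ⟨Nat.sub_add_cancel hi0, rfl⟩)

theorem not_holds_initial {V : Type*} {G : Digraph V} {μ : Memory M V} (h : IsInitial G μ) {v : V}
    (hv : ¬ IsInput G v) : ¬ Holds μ v := by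
  rintro ⟨i | a, hl⟩
  · simp [h.2.1 i] at hl
  · exact hv (h.2.2 a v hl)

/-- A computation that produces the last corner of the diamond holds every vertex at some time. -/
theorem exists_visits_holds {μ ν : Memory M (Fin n × Fin n)}
    {P : List (Instr M (Fin n × Fin n))} (h0 : IsInitial (diamond n) μ)
    (hr : Run (diamond n) μ P ν) (hout : ∀ v, IsOutput (diamond n) v → Holds ν v)
    (v : Fin n × Fin n) : ∃ ξ, Visits (diamond n) μ P ξ ∧ Holds ξ v := by
  have step : ∀ u w : Fin n × Fin n, (diamond n).Adj u w →
      (∃ ξ, Visits (diamond n) μ P ξ ∧ Holds ξ w) →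
      ∃ ξ, Visits (diamond n) μ P ξ ∧ Holds ξ u := by
    rintro u w huw ⟨ξ, hv, hh⟩
    have hin : ¬ IsInput (diamond n) w := fun h => h u huw
    obtain ⟨I, ζ, hζ, -, hI, hn, hy⟩ :=
      hv.exists_first (fun μ => Holds μ w) (not_holds_initial h0 hin) hh
    exact ⟨ζ, hζ, Instr.preds_of_new hI hn hy u huw⟩
  -- Induct on the distance to the last corner, which is the only output.
  obtain ⟨d, hd⟩ : ∃ d, d = (n - 1 - v.1.val) + (n - 1 - v.2.val) := ⟨_, rfl⟩
  induction d generalizing v with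
  | zero =>
    refine ⟨ν, ⟨P, List.prefix_rfl, hr⟩, hout v fun w hw => ?_⟩
    have := w.1.isLt
    have := w.2.isLt
    rcases hw with hw | hw <;> omega
  | succ d ih =>
    obtain ⟨⟨i, hi⟩, ⟨j, hj⟩⟩ := v
    simp only at hd
    by_cases hlt : i + 1 < n
    · exact step _ (⟨i + 1, hlt⟩, ⟨j, hj⟩) (Or.inl ⟨rfl, rfl⟩) (ih _ (by simp only; omega))
    · have hlt' : j + 1 < n := by omega
      exact step _ (⟨i, hi⟩, ⟨j + 1, hlt'⟩) (Or.inr ⟨rfl, rfl⟩) (ih _ (by simp only; omega))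

/-- Some vertex in column `x` and on antidiagonal `k - 1 + t`, relative to the corner `(a, b)`, is
held. -/
def HoldsAt (a b k : ℕ) (μ : Memory M (Fin n × Fin n)) (t x : ℕ) : Prop :=
  ∃ v : Fin n × Fin n, Holds μ v ∧ v.1.val = a + x ∧ v.2.val + x + 1 = b + k + t

/-- During a computation, each `k × k` block of the diamond has at some time `k` of its vertices in
memory. -/
theorem exists_visits_block {μ : Memory M (Fin n × Fin n)} {P : List (Instr M (Fin n × Fin n))}
    (h0 : IsInitial (diamond n) μ)
    (hall : ∀ v, ∃ ξ, Visits (diamond n) μ P ξ ∧ Holds ξ v)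
    {a b k : ℕ} (hk : 2 ≤ k) (ha : a + k ≤ n) (hb : b + k ≤ n) :
    ∃ ξ, Visits (diamond n) μ P ξ ∧ ∃ S : Finset (Fin n × Fin n), S.card = k ∧ ∀ v ∈ S,
      Holds ξ v ∧ 0 < v.1.val + v.2.val ∧ a ≤ v.1.val ∧ v.1.val < a + k ∧
        b ≤ v.2.val ∧ v.2.val < b + k := by
  classical
  have hstart : ¬ ∀ g, IsGridPath k g → ∃ t < k, HoldsAt a b k μ t (g t) := by
    intro h
    -- Any path would do: `2 ≤ k` keeps the antidiagonal away from the input `(0, 0)`.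
    obtain ⟨t, ht, v, hv, h1, h2⟩ := h (fun _ => k - 1)
      ⟨fun t ht => by simp only; omega, fun t _ => Or.inl rfl⟩
    exact not_holds_initial h0 (not_isInput_diamond (by omega)) hv
  obtain ⟨η, hη, hhold⟩ := hall (⟨a + (k - 1), by omega⟩, ⟨b + (k - 1), by omega⟩)
  have hend : ∀ g, IsGridPath k g → ∃ t < k, HoldsAt a b k η t (g t) := by
    intro g hg
    have := hg.1 (k - 1) (by omega)
    exact ⟨k - 1, by omega, _, hhold, by simp only; omega, by simp only; omega⟩
  obtain ⟨I, ξ, -, hξ, hI, hn, hy⟩ := hη.exists_first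
    (fun ζ => ∀ g, IsGridPath k g → ∃ t < k, HoldsAt a b k ζ t (g t)) hstart hend
  push Not at hn
  obtain ⟨f, hf, hfree⟩ := hn
  have hfree' : ∀ t, 0 < t → t < k → ¬ HoldsAt a b k (I.exec ξ) t (f t) := by
    rintro t ht0 htk ⟨v, hv, h1, h2⟩
    have hnew : ¬ Holds ξ v := fun h => hfree t htk ⟨v, h, h1, h2⟩
    obtain ⟨s, rfl⟩ : ∃ s, t = s + 1 := ⟨t - 1, by omega⟩
    have hpre := Instr.preds_of_new hI hnew hv
    have hs := hf.1 s (by omega)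
    have hv1 := v.1.isLt
    have hv2 := v.2.isLt
    refine hfree s (by omega) ?_
    rcases hf.2 s htk with h | h
    · exact ⟨(v.1, ⟨v.2.val - 1, by omega⟩), hpre _ (Or.inr ⟨rfl, by simp only; omega⟩),
        by simp only; omega, by simp only; omega⟩
    · exact ⟨(⟨v.1.val - 1, by omega⟩, v.2), hpre _ (Or.inl ⟨by simp only; omega, rfl⟩),
        by simp only; omega, by simp only; omega⟩
  obtain ⟨S, hS, hSR⟩ := exists_card_of_blocked hf hy hfree'
  have : Nonempty (Fin n × Fin n) := ⟨(⟨a, by omega⟩, ⟨b, by omega⟩)⟩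
  choose! w hw using fun p (hp : p ∈ S) => (hSR p hp).2.2
  refine ⟨_, hξ, S.image w, ?_, ?_⟩
  · rw [Finset.card_image_of_injOn, hS]
    intro p hp q hq heq
    have h1 := hw p hp
    have h2 := hw q hq
    rw [heq] at h1
    exact Prod.ext (by omega) (by omega)
  · intro v hv
    obtain ⟨p, hp, rfl⟩ := Finset.mem_image.1 hv
    have h1 := hSR p hp
    have h2 := hw p hp
    exact ⟨h2.1, by omega, by omega, by omega, by omega, by omega⟩

/-- Each `2M × 2M` block has at least `M` vertices that are written to the asymmetric memory. -/
theorem le_asym_writes {μ : Memory M (Fin n × Fin n)} {P : List (Instr M (Fin n × Fin n))}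
    (hM : 1 ≤ M) (h0 : IsInitial (diamond n) μ)
    (hall : ∀ v, ∃ ξ, Visits (diamond n) μ P ξ ∧ Holds ξ v) :
    (n / (2 * M)) ^ 2 * M ≤ (P.map fun I => I.writes.countP Sum.isRight).sum := by
  classical
  obtain ⟨W, hW, hval⟩ := exists_finset_written (G := diamond n) Sum.isRight P μ
  refine le_trans ?_ hW
  set q := n / (2 * M) with hq
  have hqn : 2 * M * q ≤ n := Nat.mul_div_le n (2 * M)
  let φ : Fin n × Fin n → ℕ × ℕ := fun v => (v.1.val / (2 * M), v.2.val / (2 * M))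
  have hblock : ∀ c ∈ Finset.range q ×ˢ Finset.range q, M ≤ (W.filter fun v => φ v = c).card := by
    rintro ⟨i, j⟩ hc
    simp only [Finset.mem_product, Finset.mem_range] at hc
    have hi : 2 * M * i + 2 * M ≤ n := by
      have := Nat.mul_le_mul_left (2 * M) (Nat.succ_le_of_lt hc.1)
      rw [Nat.mul_succ] at this
      omega
    have hj : 2 * M * j + 2 * M ≤ n := by
      have := Nat.mul_le_mul_left (2 * M) (Nat.succ_le_of_lt hc.2)
      rw [Nat.mul_succ] at this
      omega
    obtain ⟨ξ, hξ, S, hS, hSv⟩ := exists_visits_block h0 hall (by omega : 2 ≤ 2 * M) hi hj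
    have hfast : (S.filter fun v => ∃ i : Fin M, ξ (Sum.inl i) = some v).card ≤ M := by
      have hsub : (S.filter fun v => ∃ i : Fin M, ξ (Sum.inl i) = some v).image some ⊆
          Finset.univ.image fun i : Fin M => ξ (Sum.inl i) := by
        intro o ho
        obtain ⟨v, hv, rfl⟩ := Finset.mem_image.1 ho
        obtain ⟨i, hi⟩ := (Finset.mem_filter.1 hv).2
        exact Finset.mem_image.2 ⟨i, Finset.mem_univ _, hi⟩
      have := Finset.card_le_card hsub
      rw [Finset.card_image_of_injective _ (Option.some_injective _)] at this
      exact this.trans (Finset.card_image_le.trans (by simp))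
    -- The values outside symmetric memory are non-inputs, so they were absent initially and must
    -- have been written.
    have hslow : (S.filter fun v => ¬ ∃ i : Fin M, ξ (Sum.inl i) = some v) ⊆
        W.filter fun v => φ v = (i, j) := by
      intro v hv
      obtain ⟨hvS, hvn⟩ := Finset.mem_filter.1 hv
      obtain ⟨⟨l, hl⟩, hpos, h1, h2, h3, h4⟩ := hSv v hvS
      refine Finset.mem_filter.2 ⟨?_, Prod.ext ?_ ?_⟩
      · rcases l with l | l
        · exact absurd ⟨l, hl⟩ hvn
        · rcases hval ξ hξ _ v rfl hl with ⟨l', -, hl'⟩ | h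
          · exact absurd ⟨l', hl'⟩ (not_holds_initial h0 (not_isInput_diamond hpos))
          · exact h
      · exact Nat.div_eq_of_lt_le (by rwa [Nat.mul_comm])
          (by rw [Nat.succ_mul, Nat.mul_comm]; exact h2)
      · exact Nat.div_eq_of_lt_le (by rwa [Nat.mul_comm])
          (by rw [Nat.succ_mul, Nat.mul_comm]; exact h4)
    have hsum := Finset.card_filter_add_card_filter_not (s := S)
      (fun v => ∃ i : Fin M, ξ (Sum.inl i) = some v)
    have := Finset.card_le_card hslow
    omega
  calc q ^ 2 * M = ∑ _c ∈ Finset.range q ×ˢ Finset.range q, M := by simp [sq]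
    _ ≤ ∑ c ∈ Finset.range q ×ˢ Finset.range q, (W.filter fun v => φ v = c).card :=
        Finset.sum_le_sum hblock
    _ ≤ W.card := by
        rw [Finset.sum_card_fiberwise_eq_card_filter]
        exact Finset.card_filter_le _ _

/-- All vertices but the input have to be written at least once. -/
theorem sq_le_writes {μ : Memory M (Fin n × Fin n)} {P : List (Instr M (Fin n × Fin n))}
    (h0 : IsInitial (diamond n) μ)
    (hall : ∀ v, ∃ ξ, Visits (diamond n) μ P ξ ∧ Holds ξ v) :
    n ^ 2 ≤ (P.map fun I => I.writes.countP fun _ => true).sum + 1 := by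
  classical
  obtain ⟨W, hW, hval⟩ := exists_finset_written (G := diamond n) (fun _ => true) P μ
  rcases Nat.eq_zero_or_pos n with rfl | hn
  · simp
  have hsub : (Finset.univ : Finset (Fin n × Fin n)) ⊆ insert (⟨0, hn⟩, ⟨0, hn⟩) W := by
    intro v _
    rw [Finset.mem_insert]
    by_cases hv : 0 < v.1.val + v.2.val
    · obtain ⟨ξ, hξ, l, hl⟩ := hall v
      rcases hval ξ hξ l v rfl hl with ⟨l', -, hl'⟩ | h
      · exact absurd ⟨l', hl'⟩ (not_holds_initial h0 (not_isInput_diamond hv))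
      · exact Or.inr h
    · exact Or.inl (Prod.ext (Fin.ext (by simp only; omega)) (Fin.ext (by simp only; omega)))
  have h := (Finset.card_le_card hsub).trans (Finset.card_insert_le _ _)
  simp only [Finset.card_univ, Fintype.card_prod, Fintype.card_fin] at h
  rw [sq]
  omega

end Diamond

end AsymRAM

theorem mainTheorem3 :
    ∃ c : ℝ, 0 < c ∧ ∀ (M ω n : ℕ), 1 ≤ M → 1 ≤ ω →
      ∀ P : List (AsymRAM.Instr M (Fin n × Fin n)), AsymRAM.Solves (AsymRAM.diamond n) P →
        (2 * M ≤ n → c * ((ω : ℝ) * (n : ℝ) ^ 2 / (M : ℝ)) ≤ (AsymRAM.ioCost ω P : ℝ)) ∧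
        (2 ≤ n →
          c * ((AsymRAM.ioCost ω P : ℝ) + (n : ℝ) ^ 2) ≤ (AsymRAM.work ω P : ℝ)) := by
  refine ⟨1 / 16, by norm_num, ?_⟩
  rintro M ω n hM hω P ⟨μ, ν, h0, hr, hout⟩
  have hall := AsymRAM.exists_visits_holds h0 hr hout
  refine ⟨fun hn => ?_, fun hn => ?_⟩
  · have h1 := (Nat.mul_le_mul_left ω (AsymRAM.le_asym_writes hM h0 hall)).trans
      (AsymRAM.mul_asym_writes_le_ioCost ω P)
    have hq1 : 1 ≤ n / (2 * M) := (Nat.one_le_div_iff (by omega)).2 hn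
    have hdiv := Nat.div_add_mod n (2 * M)
    have hmod := Nat.mod_lt n (by omega : 0 < 2 * M)
    set q := n / (2 * M)
    -- As `1 ≤ q`, `n < 2 * M * (q + 1) ≤ 4 * M * q`; squaring gives the constant `1 / 16`.
    have h3 : n ≤ 4 * M * q := by nlinarith
    have h1' : (ω : ℝ) * ((q : ℝ) ^ 2 * M) ≤ (AsymRAM.ioCost ω P : ℝ) := by exact_mod_cast h1
    have h3' : (n : ℝ) ≤ 4 * M * q := by exact_mod_cast h3
    have hM' : (0 : ℝ) < M := by exact_mod_cast hM
    refine le_trans ?_ h1'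
    have h4 : (n : ℝ) ^ 2 ≤ (4 * M * q) ^ 2 := by gcongr
    calc 1 / 16 * ((ω : ℝ) * (n : ℝ) ^ 2 / M)
        ≤ 1 / 16 * ((ω : ℝ) * (4 * M * q) ^ 2 / M) := by gcongr
      _ = (ω : ℝ) * ((q : ℝ) ^ 2 * M) := by field_simp; ring
  · have h1 := AsymRAM.sq_le_writes h0 hall
    have h2 := AsymRAM.writes_le_work hω P
    have h3 : n ^ 2 ≤ AsymRAM.work ω P + 1 := by omega
    have h4 : AsymRAM.ioCost ω P ≤ AsymRAM.work ω P := Nat.le_add_right _ _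
    have h3' : (n : ℝ) ^ 2 ≤ (AsymRAM.work ω P : ℝ) + 1 := by exact_mod_cast h3
    have h4' : (AsymRAM.ioCost ω P : ℝ) ≤ (AsymRAM.work ω P : ℝ) := by exact_mod_cast h4
    have hn' : (2 : ℝ) ≤ n := by exact_mod_cast hn
    -- The missing input costs only 1, which `2 ≤ n` absorbs.
    nlinarith
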